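/- Let $A$ be a unital $C^*$-algebra of real rank zero (the invertible self-adjoint elements are norm dense in the self-adjoint elements) satisfying the following condition $(\dagger)$: for every $n\in\mathbb{N}$ and every non-zero projection $p\in A$ there are non-zero pairwise orthogonal subprojections $p_1,\dots,p_n$ of $p$ in $A$ such that $p\in\overline{Ap_iA}$ for all $i$, where $\overline{AxA}$ denotes the closed two-sided ideal generated by $x$. Let $\beta:A\to A$ be an injective (not necessarily unital) $*$-endomorphism such that $\beta(A)$ is a hereditary sub-$C^*$-algebra of $A$. Let $A\times_\beta\mathbb{N}=C^*(A,V)$ be the Stacey crossed product, that is, the $C^*$-algebra generated by the universal covariant representation of $(A,\beta)$, where a covariant representation consists of a unital representation $\pi$ of $A$ on a Hilbert space and an isometry $V$ with $\pi(\beta(a))=V\pi(a)V^*$ for all $a\in A$; we regard elements of $A$ as elements of $A\times_\beta\mathbb{N}$ through the canonical map. Suppose that there is no closed two-sided ideal $I$ of $A$ with $I\neq 0$, $I\neq A$ and $\beta(I)\subseteq I$. Then for every non-zero projection $p\in A$ there exist a projection $q\in A$ that is full (i.e. $\overline{AqA}=A$) and an element $c\in A\times_\beta\mathbb{N}$ such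 that $q=cpc^*$. -/

import Mathlib

open scoped ENNReal

universe u

noncomputable section

/-- A sub-C*-algebra is hereditary if it is norm closed and contains every `a` with
`0 ≤ a ≤ b` for some element `b` of it. -/
def IsHereditarySubalgebra {A : Type u} [CStarAlgebra A] [PartialOrder A] [StarOrderedRing A]
    (S : NonUnitalStarSubalgebra ℂ A) : Prop :=
  IsClosed (S : Set A) ∧ ∀ a b : A, 0 ≤ a → a ≤ b → b ∈ S → a ∈ S

/-- A unital C*-algebra has real rank zero if the invertible self-adjoint elements are norm dense
in the self-adjoint elements. -/
def HasRealRankZero (A : Type u) [CStarAlgebra A] : Prop :=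
  ∀ a : A, IsSelfAdjoint a → ∀ ε : ℝ, 0 < ε → ∃ b : A, IsSelfAdjoint b ∧ IsUnit b ∧ ‖a - b‖ < ε

/-- The closed two-sided ideal generated by `x`: the closed linear span of `A x A`. -/
def closedIdealOf {A : Type u} [CStarAlgebra A] (x : A) : Submodule ℂ A :=
  (Submodule.span ℂ {y : A | ∃ a b : A, y = a * x * b}).topologicalClosure

/-- An element is full if it generates the whole algebra as a closed two-sided ideal. -/
def IsFullElement {A : Type u} [CStarAlgebra A] (x : A) : Prop :=
  closedIdealOf x = ⊤

/-- For every `n` and every nonzero projection `p` there are `n` nonzero, pairwise orthogonal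
subprojections of `p` (for projections, `e ≤ p` means `p * e = e`), each of which generates a
closed ideal containing `p`. -/
def SatisfiesDagger (A : Type u) [CStarAlgebra A] : Prop :=
  ∀ (n : ℕ) (p : A), IsStarProjection p → p ≠ 0 →
    ∃ e : Fin n → A,
      (∀ i, IsStarProjection (e i) ∧ e i ≠ 0 ∧ p * e i = e i ∧ p ∈ closedIdealOf (e i)) ∧
      ∀ i j, i ≠ j → e i * e j = 0

/-- A Stacey covariant representation of `(A, β)` for unital `A`, on a nonzero Hilbert space:
a representation `π` (non-degenerate, which for unital `A` means unital) and an isometry `V` with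
`π (β a) = V π(a) V*`. -/
structure StaceyCovariantRep {A : Type u} [CStarAlgebra A] (β : A →⋆ₙₐ[ℂ] A) : Type (u + 1) where
  H : Type u
  [normed : NormedAddCommGroup H]
  [inner : InnerProductSpace ℂ H]
  [complete : CompleteSpace H]
  [nontrivial : Nontrivial H]
  π : A →⋆ₐ[ℂ] (H →L[ℂ] H)
  V : H →L[ℂ] H
  isometry : star V * V = 1
  covariant : ∀ a : A, π (β a) = V * π a * star V

attribute [instance] StaceyCovariantRep.normed StaceyCovariantRep.inner
  StaceyCovariantRep.complete StaceyCovariantRep.nontrivial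

namespace Stacey

variable {A : Type u} [CStarAlgebra A] (β : A →⋆ₙₐ[ℂ] A)

/-- The C*-algebra of bounded families of operators, indexed by all covariant representations on
Hilbert spaces in the universe of `A` (every cyclic covariant representation is unitarily
equivalent to one of these). It is the algebra of block diagonal operators on the direct sum of all
these representations. -/
abbrev Ambient : Type (u + 1) :=
  lp (fun R : StaceyCovariantRep β => R.H →L[ℂ] R.H) ∞

theorem norm_V_le {β : A →⋆ₙₐ[ℂ] A} (R : StaceyCovariantRep β) : ‖R.V‖ ≤ 1 := by
  have h := CStarRing.norm_star_mul_self (x := R.V)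
  rw [R.isometry, norm_one] at h
  nlinarith [norm_nonneg R.V]

/-- The direct sum of all covariant representations, on `A`. -/
def ambientι : A →⋆ₐ[ℂ] Ambient β where
  toFun a := ⟨fun R => R.π a, memℓp_infty ⟨‖a‖, by
    rintro _ ⟨R, rfl⟩
    exact NonUnitalStarAlgHom.norm_apply_le R.π a⟩⟩
  map_one' := by ext1; funext R; exact map_one R.π
  map_mul' a b := by ext1; funext R; exact map_mul R.π a b
  map_zero' := by ext1; funext R; exact map_zero R.π
  map_add' a b := by ext1; funext R; exact map_add R.π a b
  commutes' z := by ext1; funext R; exact AlgHomClass.commutes R.π z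
  map_star' a := by ext1; funext R; exact map_star R.π a

/-- The direct sum of the isometries of all covariant representations. -/
def ambientV : Ambient β :=
  ⟨fun R => R.V, memℓp_infty ⟨1, by
    rintro _ ⟨R, rfl⟩
    exact norm_V_le R⟩⟩

/-- The Stacey crossed product `A ×_β ℕ`: the C*-algebra generated by the elements
`ι(a) V ^ n (V*) ^ m` for the universal covariant representation `(ι, V)`. -/
def CrossedProduct : StarSubalgebra ℂ (Ambient β) :=
  (StarAlgebra.adjoin ℂ
    {x : Ambient β | ∃ (a : A) (n m : ℕ),
      x = ambientι β a * ambientV β ^ n * star (ambientV β) ^ m}).topologicalClosure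

instance : Ring (CrossedProduct β) := inferInstance

instance : StarRing (CrossedProduct β) := inferInstance

instance : Semigroup (CrossedProduct β) := MonoidWithZero.toSemigroupWithZero.toSemigroup

theorem ambientι_mem (a : A) : ambientι β a ∈ CrossedProduct β :=
  StarSubalgebra.le_topologicalClosure _
    (StarAlgebra.subset_adjoin ℂ _ ⟨a, 0, 0, by simp⟩)

theorem ambientV_mem : ambientV β ∈ CrossedProduct β :=
  StarSubalgebra.le_topologicalClosure _
    (StarAlgebra.subset_adjoin ℂ _ ⟨1, 1, 0, by simp⟩)

/-- The canonical homomorphism `A → A ×_β ℕ`. -/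
def ι : A →⋆ₐ[ℂ] CrossedProduct β :=
  (ambientι β).codRestrict (CrossedProduct β) (ambientι_mem β)

/-- The canonical isometry of `A ×_β ℕ`. -/
def V : CrossedProduct β := ⟨ambientV β, ambientV_mem β⟩

theorem V_isometry : star (V β) * V β = 1 := by
  apply Subtype.ext
  ext1
  funext R
  exact R.isometry

theorem ι_covariant (a : A) : ι β (β a) = V β * ι β a * star (V β) := by
  apply Subtype.ext
  ext1
  funext R
  exact R.covariant a

end Stacey

end

/-!
By minimality the orbit of `p` generates `A` as a closed ideal, and since the units are open,
finitely many iterates `β^[k] p` with `k < n` already do. Condition `(†)` provides orthogonal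
projections `e k ≤ p` for `k < n`, each generating a closed ideal that contains `p`. In the crossed
product `β^[k] (e k) = V ^ k * e k * star (V ^ k)`, so by orthogonality the sum `y` of the
projections `β^[k] (e k)` equals `c * p * star c` with `c = ∑ k, V ^ k * e k`.

Real rank zero gives a projection `g` that nearly is a spectral projection of `y`: the corner
`g * y * g` is bounded below, so `g = t * y * star t` for some `t : A`, and
`(1 - g) * y * (1 - g) ≤ 1 / 2`. A projection `f ≤ y` then satisfies `‖f - f * g * f‖ < 1`, which
puts `f` in the closed ideal generated by `g`. This applies to every `β^[k] (e k)`, hence `g` is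
full.
-/

section ClosedIdeal

variable {A : Type u} [CStarAlgebra A]

/-- The closed two-sided ideal generated by a set, as a submodule; for a singleton it is
`closedIdealOf`. -/
noncomputable def closedIdealSpan (s : Set A) : Submodule ℂ A :=
  (Submodule.span ℂ {y : A | ∃ x ∈ s, ∃ a b : A, y = a * x * b}).topologicalClosure

theorem closedIdealSpan_singleton (x : A) : closedIdealSpan {x} = closedIdealOf x := by
  simp only [closedIdealSpan, closedIdealOf, Set.mem_singleton_iff, exists_eq_left]

theorem isClosed_closedIdealSpan (s : Set A) : IsClosed (closedIdealSpan s : Set A) :=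
  Submodule.isClosed_topologicalClosure _

theorem mul_mul_mem_closedIdealSpan_of_mem {s : Set A} {x : A} (hx : x ∈ s) (a b : A) :
    a * x * b ∈ closedIdealSpan s :=
  Submodule.le_topologicalClosure _ (Submodule.subset_span ⟨x, hx, a, b, rfl⟩)

theorem subset_closedIdealSpan (s : Set A) : s ⊆ closedIdealSpan s := fun x hx => by
  simpa using mul_mul_mem_closedIdealSpan_of_mem hx 1 1

theorem closedIdealSpan_le {s : Set A} {J : Submodule ℂ A} (hJ : IsClosed (J : Set A))
    (h : ∀ x ∈ s, ∀ a b : A, a * x * b ∈ J) : closedIdealSpan s ≤ J := by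
  refine Submodule.topologicalClosure_minimal _ (Submodule.span_le.2 ?_) hJ
  rintro _ ⟨x, hx, a, b, rfl⟩
  exact h x hx a b

theorem mul_mul_mem_closedIdealSpan {s : Set A} {z : A} (hz : z ∈ closedIdealSpan s) (a b : A) :
    a * z * b ∈ closedIdealSpan s := by
  have hclosed : IsClosed {y : A | a * y * b ∈ closedIdealSpan s} :=
    (isClosed_closedIdealSpan s).preimage (by fun_prop)
  refine closedIdealSpan_le (J := (closedIdealSpan s).comap (LinearMap.mulLeftRight ℂ (a, b)))
    hclosed (fun x hx c d => ?_) hz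
  have hassoc : a * (c * x * d) * b = (a * c) * x * (d * b) := by noncomm_ring
  simpa [hassoc] using mul_mul_mem_closedIdealSpan_of_mem hx (a * c) (d * b)

theorem closedIdealSpan_le_closedIdealSpan {s t : Set A} (h : s ⊆ closedIdealSpan t) :
    closedIdealSpan s ≤ closedIdealSpan t :=
  closedIdealSpan_le (isClosed_closedIdealSpan t) fun _ hx => mul_mul_mem_closedIdealSpan (h hx)

theorem closedIdealSpan_mono {s t : Set A} (h : s ⊆ t) : closedIdealSpan s ≤ closedIdealSpan t :=
  closedIdealSpan_le_closedIdealSpan (h.trans (subset_closedIdealSpan t))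

theorem map_mem_closedIdealSpan {B : Type*} [CStarAlgebra B] (φ : A →⋆ₙₐ[ℂ] B) {s : Set A}
    {t : Set B} (h : Set.MapsTo φ s t) {z : A} (hz : z ∈ closedIdealSpan s) :
    φ z ∈ closedIdealSpan t := by
  have hclosed : IsClosed {y : A | φ y ∈ closedIdealSpan t} :=
    (isClosed_closedIdealSpan t).preimage <|
      AddMonoidHomClass.continuous_of_bound φ 1 fun x => by
        simpa using NonUnitalStarAlgHom.norm_apply_le φ x
  refine closedIdealSpan_le (J := (closedIdealSpan t).comap (φ : A →ₗ[ℂ] B))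
    hclosed (fun x hx a b => ?_) hz
  simpa using mul_mul_mem_closedIdealSpan_of_mem (h hx) (φ a) (φ b)

theorem closedIdealSpan_eq_top_of_isUnit_mem {s : Set A} {z : A} (hz : IsUnit z)
    (h : z ∈ closedIdealSpan s) : closedIdealSpan s = ⊤ := by
  obtain ⟨v, rfl⟩ := hz
  refine eq_top_iff.2 fun y _ => ?_
  simpa using mul_mul_mem_closedIdealSpan h 1 (↑v⁻¹ * y)

/-- Units form an open set, so the algebraic ideal generated by `s` already contains one. -/
theorem exists_finite_subset_closedIdealSpan_eq_top {s : Set A} (h : closedIdealSpan s = ⊤) :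
    ∃ t ⊆ s, t.Finite ∧ closedIdealSpan t = ⊤ := by
  have hone : (1 : A) ∈ closedIdealSpan s := h ▸ Submodule.mem_top
  obtain ⟨z, hz, hzs⟩ := mem_closure_iff.1 hone _ Units.isOpen isUnit_one
  obtain ⟨T, hT, hzT⟩ := Submodule.mem_span_finite_of_mem_span hzs
  have hfactor : ∀ y ∈ T, ∃ x ∈ s, ∃ a b : A, y = a * x * b := fun y hy => hT hy
  choose! x hx a b hab using hfactor
  refine ⟨x '' T, Set.image_subset_iff.2 hx, T.finite_toSet.image x,
    closedIdealSpan_eq_top_of_isUnit_mem hz (Submodule.le_topologicalClosure _ ?_)⟩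
  have hsub : (T : Set A) ⊆ {y | ∃ z ∈ x '' T, ∃ a b : A, y = a * z * b} := fun y hy =>
    ⟨x y, Set.mem_image_of_mem x hy, a y, b y, hab y hy⟩
  exact Submodule.span_mono hsub hzT

theorem closedIdealSpan_eq_top_of_mapsTo (β : A →⋆ₙₐ[ℂ] A)
    (hideal : ∀ I : TwoSidedIdeal A, IsClosed (I : Set A) → (∀ a ∈ I, β a ∈ I) →
      I = ⊥ ∨ I = ⊤)
    {s : Set A} (hs : Set.MapsTo β s s) {x : A} (hx : x ∈ s) (hx0 : x ≠ 0) :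
    closedIdealSpan s = ⊤ := by
  let I : TwoSidedIdeal A := .mk' (closedIdealSpan s) (zero_mem _) add_mem neg_mem
    (fun {a z} hz => by simpa using mul_mul_mem_closedIdealSpan hz a 1)
    (fun {z a} hz => by simpa using mul_mul_mem_closedIdealSpan hz 1 a)
  have hmem : ∀ z, z ∈ I ↔ z ∈ closedIdealSpan s := TwoSidedIdeal.mem_mk' _ _ _ _ _ _
  have hclosed : IsClosed (I : Set A) := by
    convert isClosed_closedIdealSpan s using 1
    exact Set.ext hmem
  have hinv : ∀ z ∈ I, β z ∈ I := fun z hz =>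
    (hmem _).2 (map_mem_closedIdealSpan β hs ((hmem z).1 hz))
  rcases hideal I hclosed hinv with hI | hI
  · have hxI : x ∈ I := (hmem x).2 (subset_closedIdealSpan s hx)
    exact absurd ((TwoSidedIdeal.mem_bot A).1 (hI ▸ hxI)) hx0
  · exact eq_top_iff.2 fun z _ => (hmem z).1 (hI ▸ TwoSidedIdeal.mem_top A)

theorem exists_closedIdealSpan_iterate_eq_top (β : A →⋆ₙₐ[ℂ] A)
    (hideal : ∀ I : TwoSidedIdeal A, IsClosed (I : Set A) → (∀ a ∈ I, β a ∈ I) →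
      I = ⊥ ∨ I = ⊤)
    {p : A} (hp0 : p ≠ 0) :
    ∃ n : ℕ, closedIdealSpan ((fun k => β^[k] p) '' Set.Iio n) = ⊤ := by
  have horbit : Set.MapsTo β ((fun k => β^[k] p) '' Set.univ) ((fun k => β^[k] p) '' Set.univ) := by
    rintro _ ⟨k, -, rfl⟩
    exact ⟨k + 1, trivial, Function.iterate_succ_apply' β k p⟩
  obtain ⟨K, -, hK, htop⟩ := Set.exists_subset_image_finite_and.1
    (exists_finite_subset_closedIdealSpan_eq_top
      (closedIdealSpan_eq_top_of_mapsTo β hideal horbit ⟨0, trivial, rfl⟩ hp0))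
  obtain ⟨m, hm⟩ := hK.bddAbove
  have hKm : K ⊆ Set.Iio (m + 1) := fun k hk => Nat.lt_succ_of_le (hm hk)
  exact ⟨m + 1, top_unique (htop ▸ closedIdealSpan_mono (Set.image_mono hKm))⟩

theorem iterate_mem_closedIdealOf (φ : A →⋆ₙₐ[ℂ] A) {x y : A} (h : x ∈ closedIdealOf y) (k : ℕ) :
    φ^[k] x ∈ closedIdealOf (φ^[k] y) := by
  simp only [← closedIdealSpan_singleton] at h ⊢
  induction k with
  | zero => exact h
  | succ k ih =>
    simp only [Function.iterate_succ_apply']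
    exact map_mem_closedIdealSpan φ (Set.mapsTo_singleton.2 (Set.mem_singleton _)) ih

theorem mem_closedIdealOf_of_norm_sub_lt_one {f y : A} (hf : IsIdempotentElem f)
    (h : ‖f - f * y * f‖ < 1) : f ∈ closedIdealOf y := by
  obtain ⟨w, hw⟩ := isUnit_one_sub_of_norm_lt_one h
  have hfw : f * w = f * y * f := by
    rw [hw, mul_sub, mul_sub, mul_one, ← mul_assoc, ← mul_assoc, hf.eq]
    abel
  have hf_eq : f = f * y * (f * ↑w⁻¹) := by
    rw [← mul_assoc, ← hfw, mul_assoc, Units.mul_inv, mul_one]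
  rw [hf_eq, ← closedIdealSpan_singleton]
  exact mul_mul_mem_closedIdealSpan_of_mem (Set.mem_singleton y) f _

end ClosedIdeal

section SpectralCut

variable {A : Type u} [CStarAlgebra A] [PartialOrder A] [StarOrderedRing A]

/-- The projection is the spectral projection of `b` for `(0, ∞)`, which lies in `A` because `b`
has a spectral gap at `0`. -/
theorem exists_isStarProjection_conjugate_nonneg_nonpos {b : A} (hb : IsSelfAdjoint b)
    (hu : IsUnit b) :
    ∃ g : A, IsStarProjection g ∧ 0 ≤ g * b * g ∧ (1 - g) * b * (1 - g) ≤ 0 := by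
  let χ : ℝ → ℝ := fun t => if 0 < t then 1 else 0
  have hχ : ContinuousOn χ (spectrum ℝ b) := by
    intro t ht
    have ht0 : t ≠ 0 := fun h => (spectrum.zero_notMem_iff ℝ).2 hu (h ▸ ht)
    refine ContinuousAt.continuousWithinAt ?_
    rcases lt_or_gt_of_ne ht0 with hneg | hpos
    · refine continuousAt_const.congr (f := fun _ => 0) ?_
      filter_upwards [eventually_lt_nhds hneg] with s hs using (if_neg hs.not_gt).symm
    · refine continuousAt_const.congr (f := fun _ => 1) ?_
      filter_upwards [eventually_gt_nhds hpos] with s hs using (if_pos hs).symm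
  have hχ' : ContinuousOn (fun t => 1 - χ t) (spectrum ℝ b) := continuousOn_const.sub hχ
  have hcompl : 1 - cfc χ b = cfc (fun t => 1 - χ t) b := by
    rw [cfc_sub (fun _ => (1 : ℝ)) χ b, cfc_const_one ℝ b]
  have hconj : ∀ ψ : ℝ → ℝ, ContinuousOn ψ (spectrum ℝ b) →
      cfc ψ b * b * cfc ψ b = cfc (fun t => ψ t * t * ψ t) b := fun ψ hψ => by
    rw [cfc_mul (fun t => ψ t * t) ψ b (hψ.mul continuousOn_id) hψ,
      cfc_mul ψ (fun t => t) b hψ continuousOn_id, cfc_id' ℝ b]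
  have hidem : IsIdempotentElem (cfc χ b) := by
    have hχχ : (fun t => χ t * χ t) = χ := by funext t; simp [χ]
    rw [IsIdempotentElem, ← cfc_mul χ χ b hχ hχ, hχχ]
  refine ⟨cfc χ b, ⟨hidem, cfc_predicate χ b⟩, ?_, ?_⟩
  · rw [hconj χ hχ]
    refine cfc_nonneg fun t _ => ?_
    by_cases ht : 0 < t <;> simp [χ, ht, le_of_lt]
  · rw [hcompl, hconj _ hχ']
    refine cfc_nonpos _ b fun t _ => ?_
    by_cases ht : 0 < t
    · simp [χ, ht]
    · simpa [χ, ht] using not_lt.1 ht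

/-- Here `b` is an invertible perturbation of `a - (s + t) / 2` by at most `(t - s) / 2`. -/
theorem HasRealRankZero.exists_isUnit_add_algebraMap_le (hrr : HasRealRankZero A)
    {a : A} (ha : IsSelfAdjoint a) {s t : ℝ} (hst : s < t) :
    ∃ b : A, IsSelfAdjoint b ∧ IsUnit b ∧ b + algebraMap ℝ A s ≤ a ∧ a ≤ b + algebraMap ℝ A t := by
  have hshift : IsSelfAdjoint (a - algebraMap ℝ A ((s + t) / 2)) :=
    ha.sub (.algebraMap A (.all _))
  obtain ⟨b, hb, hu, hab⟩ := hrr _ hshift ((t - s) / 2) (by linarith)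
  have hsa : IsSelfAdjoint (a - algebraMap ℝ A ((s + t) / 2) - b) := hshift.sub hb
  refine ⟨b, hb, hu, ?_, ?_⟩
  · have hs : algebraMap ℝ A s = -algebraMap ℝ A ((t - s) / 2) + algebraMap ℝ A ((s + t) / 2) := by
      rw [← map_neg, ← map_add]
      congr 1
      ring
    have hlower := (neg_le_neg (algebraMap_mono A hab.le)).trans hsa.neg_algebraMap_norm_le_self
    rw [le_sub_iff_add_le, le_sub_iff_add_le] at hlower
    rwa [hs, add_comm b, add_right_comm]
  · have ht : algebraMap ℝ A t = algebraMap ℝ A ((t - s) / 2) + algebraMap ℝ A ((s + t) / 2) := by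
      rw [← map_add]
      congr 1
      ring
    have hupper := hsa.le_algebraMap_norm_self.trans (algebraMap_mono A hab.le)
    rw [sub_le_iff_le_add, sub_le_iff_le_add] at hupper
    rwa [ht, add_comm b, add_right_comm]

theorem HasRealRankZero.exists_isStarProjection_smul_le_conjugate_le (hrr : HasRealRankZero A)
    {a : A} (ha : IsSelfAdjoint a) {s t : ℝ} (hst : s < t) :
    ∃ g : A, IsStarProjection g ∧ s • g ≤ g * a * g ∧
      (1 - g) * a * (1 - g) ≤ t • (1 - g) := by
  obtain ⟨b, hb, hu, hlower, hupper⟩ := hrr.exists_isUnit_add_algebraMap_le ha hst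
  obtain ⟨g, hg, hpos, hneg⟩ := exists_isStarProjection_conjugate_nonneg_nonpos hb hu
  have hconj : ∀ (e : A) (r : ℝ), IsStarProjection e →
      e * (b + algebraMap ℝ A r) * e = e * b * e + r • e := fun e r he => by
    rw [Algebra.algebraMap_eq_smul_one, mul_add, add_mul, mul_smul_comm, mul_one, smul_mul_assoc,
      he.isIdempotentElem.eq]
  refine ⟨g, hg, ?_, ?_⟩
  · calc s • g ≤ g * b * g + s • g := le_add_of_nonneg_left hpos
      _ = g * (b + algebraMap ℝ A s) * g := (hconj g s hg).symm
      _ ≤ g * a * g := hg.isSelfAdjoint.conjugate_le_conjugate hlower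
  · calc (1 - g) * a * (1 - g) ≤ (1 - g) * (b + algebraMap ℝ A t) * (1 - g) :=
          hg.one_sub.isSelfAdjoint.conjugate_le_conjugate hupper
      _ = (1 - g) * b * (1 - g) + t • (1 - g) := hconj _ t hg.one_sub
      _ ≤ t • (1 - g) := add_le_of_nonpos_left hneg

/-- The conjugating element is `g * d ^ (-1 / 2)`, where `d = g * a * g + (1 - g)` is invertible
and commutes with `g`. -/
theorem exists_conjugate_eq_of_smul_le_conjugate {a g : A} (hg : IsStarProjection g) {ε : ℝ}
    (hε : 0 < ε) (h : ε • g ≤ g * a * g) : ∃ t : A, t * a * star t = g := by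
  have hgg : g * g = g := hg.isIdempotentElem
  set d := g * a * g + (1 - g) with hd
  have hgd : g * d = g * a * g := by
    rw [hd, mul_add, hg.mul_one_sub_self, add_zero, ← mul_assoc, ← mul_assoc, hgg]
  have hdg : d * g = g * a * g := by
    rw [hd, add_mul, hg.one_sub_mul_self, add_zero, mul_assoc, hgg]
  have hbound : algebraMap ℝ A (min ε 1) ≤ d := by
    calc algebraMap ℝ A (min ε 1) = min ε 1 • g + min ε 1 • (1 - g) := by
          rw [Algebra.algebraMap_eq_smul_one]
          module
      _ ≤ ε • g + (1 : ℝ) • (1 - g) := by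
          gcongr
          · exact hg.nonneg
          · exact min_le_left ε 1
          · exact hg.one_sub.nonneg
          · exact min_le_right ε 1
      _ ≤ d := by
          rw [one_smul]
          exact add_le_add_left h _
  have hmin : 0 < min ε 1 := lt_min hε one_pos
  have hdpos : IsStrictlyPositive d :=
    IsStrictlyPositive.of_le (IsStrictlyPositive.iff_of_unital.2 ⟨algebraMap_nonneg A hmin.le,
      (IsUnit.mk0 _ hmin.ne').map (algebraMap ℝ A)⟩) hbound
  set s := d ^ (-(1 / 2) : ℝ)
  have hsg : s * g = g * s := (Commute.cfc_nnreal (hdg.trans hgd.symm) _).eq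
  have hsds : s * d * s = 1 := CFC.conjugate_rpow_neg_one_half d
  have hstar : star (g * s) = s * g := by
    rw [star_mul, hg.isSelfAdjoint.star_eq, (IsSelfAdjoint.of_nonneg CFC.rpow_nonneg).star_eq]
  refine ⟨g * s, ?_⟩
  calc g * s * a * star (g * s) = s * (g * a * g) * s := by
        rw [hstar, ← hsg]
        simp only [← mul_assoc, hsg]
    _ = s * d * s * g := by rw [← hdg, mul_assoc, mul_assoc, ← hsg, ← mul_assoc, ← mul_assoc]
    _ = g := by rw [hsds, one_mul]

theorem mem_closedIdealOf_of_conjugate_one_sub_le {a f g : A} (hf : IsStarProjection f)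
    (hfa : f ≤ a) (hg : IsStarProjection g) {t : ℝ} (ht0 : 0 ≤ t) (ht1 : t < 1)
    (hcut : (1 - g) * a * (1 - g) ≤ t • (1 - g)) : f ∈ closedIdealOf g := by
  have hr : IsStarProjection (1 - g) := hg.one_sub
  have hle : (1 - g) * f * (1 - g) ≤ algebraMap ℝ A t :=
    calc (1 - g) * f * (1 - g) ≤ t • (1 - g) :=
          (hr.isSelfAdjoint.conjugate_le_conjugate hfa).trans hcut
      _ ≤ t • (1 : A) := smul_le_smul_of_nonneg_left (sub_le_self _ hg.nonneg) ht0
      _ = algebraMap ℝ A t := (Algebra.algebraMap_eq_smul_one t).symm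
  have hnorm : ‖(1 - g) * f * (1 - g)‖ ≤ t :=
    (CStarAlgebra.norm_le_iff_le_algebraMap _ ht0
      (hr.isSelfAdjoint.conjugate_nonneg hf.nonneg)).2 hle
  have hsymm : ‖f * (1 - g) * f‖ = ‖(1 - g) * f * (1 - g)‖ := by
    have hstar : star ((1 - g) * f) = f * (1 - g) := by
      rw [star_mul, hf.isSelfAdjoint.star_eq, hr.isSelfAdjoint.star_eq]
    calc ‖f * (1 - g) * f‖ = ‖star ((1 - g) * f) * ((1 - g) * f)‖ := by
          rw [hstar, ← mul_assoc, mul_assoc f (1 - g) (1 - g), hr.isIdempotentElem.eq]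
      _ = ‖(1 - g) * f * star ((1 - g) * f)‖ := by
          rw [CStarRing.norm_star_mul_self, CStarRing.norm_self_mul_star]
      _ = ‖(1 - g) * f * (1 - g)‖ := by
          rw [hstar, ← mul_assoc, mul_assoc _ f f, hf.isIdempotentElem.eq]
  refine mem_closedIdealOf_of_norm_sub_lt_one hf.isIdempotentElem ?_
  calc ‖f - f * g * f‖ = ‖f * (1 - g) * f‖ := by
        rw [mul_sub, mul_one, sub_mul, hf.isIdempotentElem.eq]
    _ ≤ t := hsymm.trans_le hnorm
    _ < 1 := ht1

end SpectralCut

theorem HasRealRankZero.exists_isStarProjection_eq_conjugate_sum {A : Type u} [CStarAlgebra A]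
    (hrr : HasRealRankZero A) {κ : Type*} [Fintype κ] {f : κ → A}
    (hf : ∀ i, IsStarProjection (f i)) :
    ∃ g t : A, IsStarProjection g ∧ t * (∑ i, f i) * star t = g ∧ ∀ i, f i ∈ closedIdealOf g := by
  let _ := CStarAlgebra.spectralOrder A
  have := CStarAlgebra.spectralOrderedRing A
  have hsa : IsSelfAdjoint (∑ i, f i) :=
    .of_nonneg (Finset.sum_nonneg fun i _ => (hf i).nonneg)
  obtain ⟨g, hg, hlower, hupper⟩ :=
    hrr.exists_isStarProjection_smul_le_conjugate_le hsa (s := 1 / 3) (t := 1 / 2) (by norm_num)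
  obtain ⟨t, ht⟩ := exists_conjugate_eq_of_smul_le_conjugate hg (by norm_num) hlower
  refine ⟨g, t, hg, ht, fun i => ?_⟩
  have hle : f i ≤ ∑ i, f i :=
    Finset.single_le_sum (fun j _ => (hf j).nonneg) (Finset.mem_univ i)
  exact mem_closedIdealOf_of_conjugate_one_sub_le (hf i) hle hg (by norm_num) (by norm_num) hupper

section CovariantPair

theorem sum_mul_conjugate_of_orthogonal {R κ : Type*} [NonUnitalSemiring R] [StarRing R]
    [Fintype κ] {p : R} {e : κ → R} (he : ∀ i, IsStarProjection (e i)) (hpe : ∀ i, p * e i = e i)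
    (horth : ∀ i j, i ≠ j → e i * e j = 0) (x : κ → R) :
    (∑ i, x i * e i) * p * star (∑ i, x i * e i) = ∑ i, x i * e i * star (x i) := by
  have hterm : ∀ i j, x i * e i * p * star (x j * e j) = x i * (e i * e j) * star (x j) :=
    fun i j => by
      rw [star_mul, (he j).isSelfAdjoint.star_eq]
      simp only [mul_assoc]
      rw [← mul_assoc p, hpe]
  simp only [star_sum, Finset.sum_mul, Finset.mul_sum, hterm]
  refine Finset.sum_congr rfl fun i _ => ?_
  rw [Finset.sum_eq_single i (fun j _ hji => by simp [horth _ _ hji]) (by simp),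
    (he i).isIdempotentElem.eq]

theorem map_iterate_eq_conjugate_pow {X B : Type*} [Monoid B] [StarMul B] {β : X → X} {φ : X → B}
    {v : B} (hv : ∀ a, φ (β a) = v * φ a * star v) (k : ℕ) (a : X) :
    φ (β^[k] a) = v ^ k * φ a * star (v ^ k) := by
  induction k with
  | zero => simp
  | succ k ih =>
    rw [Function.iterate_succ_apply', hv, ih, pow_succ', star_mul]
    simp only [mul_assoc]

theorem map_sum_iterate_eq_conjugate {A B F : Type*} [NonUnitalSemiring A] [StarRing A]
    [Semiring B] [StarRing B] [FunLike F A B] [NonUnitalRingHomClass F A B] [StarHomClass F A B]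
    {β : A → A} {φ : F} {v : B} (hv : ∀ a, φ (β a) = v * φ a * star v) {n : ℕ} {p : A}
    {e : Fin n → A} (he : ∀ i, IsStarProjection (e i)) (hpe : ∀ i, p * e i = e i)
    (horth : ∀ i j, i ≠ j → e i * e j = 0) :
    φ (∑ i : Fin n, β^[i] (e i)) =
      (∑ i : Fin n, v ^ (i : ℕ) * φ (e i)) * φ p * star (∑ i : Fin n, v ^ (i : ℕ) * φ (e i)) := by
  rw [sum_mul_conjugate_of_orthogonal (fun i => (he i).map φ)
    (fun i => by rw [← map_mul, hpe]) (fun i j hij => by rw [← map_mul, horth i j hij, map_zero]),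
    map_sum]
  exact Finset.sum_congr rfl fun i _ => map_iterate_eq_conjugate_pow hv i (e i)

end CovariantPair

theorem mainTheorem10_general {A : Type u} [CStarAlgebra A]
    (hrr : HasRealRankZero A) (hdagger : SatisfiesDagger A) (β : A →⋆ₙₐ[ℂ] A)
    (hideal : ∀ I : TwoSidedIdeal A, IsClosed (I : Set A) → (∀ a ∈ I, β a ∈ I) →
      I = ⊥ ∨ I = ⊤)
    {B F : Type*} [Semiring B] [StarRing B] [FunLike F A B] [NonUnitalRingHomClass F A B]
    [StarHomClass F A B] (φ : F) (v : B)
    (hv : ∀ a, φ (β a) = v * φ a * star v)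
    (p : A) (hp : IsStarProjection p) (hp0 : p ≠ 0) :
    ∃ q : A, IsStarProjection q ∧ IsFullElement q ∧ ∃ c : B, φ q = c * φ p * star c := by
  obtain ⟨n, hn⟩ := exists_closedIdealSpan_iterate_eq_top β hideal hp0
  obtain ⟨e, he, horth⟩ := hdagger n p hp hp0
  have hproj : ∀ i : Fin n, IsStarProjection (β^[i] (e i)) := fun i =>
    Set.MapsTo.iterate (s := {x | IsStarProjection x}) (fun _ hx => hx.map β) i (he i).1
  obtain ⟨q, t, hq, htq, hmem⟩ := hrr.exists_isStarProjection_eq_conjugate_sum hproj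
  simp only [← closedIdealSpan_singleton] at hmem
  refine ⟨q, hq, ?_, φ t * ∑ i : Fin n, v ^ (i : ℕ) * φ (e i), ?_⟩
  · rw [IsFullElement, ← closedIdealSpan_singleton, ← top_le_iff, ← hn]
    refine closedIdealSpan_le_closedIdealSpan (Set.image_subset_iff.2 fun k hk => ?_)
    have hpk := iterate_mem_closedIdealOf β (he ⟨k, hk⟩).2.2.2 k
    rw [← closedIdealSpan_singleton] at hpk
    exact closedIdealSpan_le_closedIdealSpan (Set.singleton_subset_iff.2 (hmem ⟨k, hk⟩)) hpk
  · rw [← htq, map_mul, map_mul, map_star, map_sum_iterate_eq_conjugate hv (fun i => (he i).1)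
      (fun i => (he i).2.2.1) horth, star_mul]
    simp only [mul_assoc]

theorem mainTheorem10 {A : Type u} [CStarAlgebra A] [PartialOrder A] [StarOrderedRing A]
    (hrr : HasRealRankZero A) (hdagger : SatisfiesDagger A)
    (β : A →⋆ₙₐ[ℂ] A) (hβ : Function.Injective β)
    (hher : IsHereditarySubalgebra (NonUnitalStarAlgHom.range β))
    (hideal : ∀ I : TwoSidedIdeal A, IsClosed (I : Set A) → (∀ a ∈ I, β a ∈ I) →
      I = ⊥ ∨ I = ⊤)
    (p : A) (hp : IsStarProjection p) (hp0 : p ≠ 0) :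
    ∃ q : A, IsStarProjection q ∧ IsFullElement q ∧
      ∃ c : Stacey.CrossedProduct β,
        Stacey.ι β q = c * Stacey.ι β p * star c :=
  mainTheorem10_general hrr hdagger β hideal (Stacey.ι β) (Stacey.V β)
    (Stacey.ι_covariant β) p hp hp0
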